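/- Let $\mathbb K\in\{\mathbb R,\mathbb C\}$ and let $\mathcal F(\Omega)$ be a locally convex Hausdorff space of $\mathbb K$-valued functions on a non-empty set $\Omega$ (a linear subspace of $\mathbb K^\Omega$ with some locally convex Hausdorff topology). For a locally convex Hausdorff space $Y$ over $\mathbb K$ let $Y_b'$ be its topological dual $Y'$ with the topology of uniform convergence on bounded sets. A triple $(\delta,Y,T)$ of a locally convex Hausdorff space $Y$ over $\mathbb K$, a map $\delta\colon\Omega\to Y$ and an algebraic isomorphism $T\colon\mathcal F(\Omega)\to Y'$ is called a linearisation of $\mathcal F(\Omega)$ if $T(f)\circ\delta=f$ for all $f\in\mathcal F(\Omega)$; it is called strong if $T\colon\mathcal F(\Omega)\to Y_b'$ is a topological isomorphism. For a locally convex Hausdorff space $E$ over $\mathbb K$ let $\mathcal F(\Omega,E)_{\sigma,b}$ be the space of all $f\colon\Omega\to E$ such that $e'\circ f\in\mathcal F(\Omega)$ for all $e'\in E'$ and $\sup\{q(e'\circ f)\mid e'\in E',\ |e'(x)|\le 1\text{ whenever }p(x)<1\}<\infty$ for all continuous seminorms $q$ on $\mathcal F(\Omega)$ and $p$ on $E$.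 Let $(\delta,Y,T)$ be a strong linearisation of $\mathcal F(\Omega)$ with $Y$ quasi-barrelled, and let $(\widetilde\delta,Z,\widetilde T)$ be a linearisation of $\mathcal F(\Omega)$ with $Z$ complete and $\widetilde\delta\in\mathcal F(\Omega,Z)_{\sigma,b}$. Then there is exactly one continuous linear map $S\colon Y\to Z$ with $S\circ\delta=\widetilde\delta$; it is denoted by $T_Z(\widetilde\delta)$. The following assertions hold. (a) The linear continuous map $T_Z(\widetilde\delta)\colon Y\to Z$ is injective and has dense range, $\widetilde T^{-1}\colon Z_b'\to\mathcal F(\Omega)$ is continuous, and the transpose $T_Z(\widetilde\delta)^t\colon Z'\to Y'$, $z'\mapsto z'\circ T_Z(\widetilde\delta)$, satisfies $T_Z(\widetilde\delta)^t=T\circ\widetilde T^{-1}$. (b) If (i) $Z_b'$ is webbed and $\mathcal F(\Omega)$ is ultrabornological, or (ii) $Z_b'$ is $B_r$-complete and $\mathcal F(\Omega)$ is barrelled, then $\widetilde T\colon\mathcal F(\Omega)\to Z_b'$ is a topological isomorphism. (c) If $Y$ is complete, $Z$ is barrelled and $\widetilde T\colon\mathcal F(\Omega)\to Z_b'$ is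 continuous, then $T_Z(\widetilde\delta)$ is surjective. (d) If $\widetilde T\colon\mathcal F(\Omega)\to Z_b'$ is continuous and (i) $Y$ is complete and webbed and $Z$ is ultrabornological, or (ii) $Y$ is $B_r$-complete and $Z$ is barrelled, then $T_Z(\widetilde\delta)$ is a topological isomorphism. -/

import Mathlib

open Filter Topology Set

universe u v

/-! ### Classes of locally convex spaces

Throughout `𝕜` is `ℝ` or `ℂ`; the spaces are topological vector spaces over `𝕜` whose underlying
real structure is the restriction of the `𝕜`-structure, so that "absolutely convex" means
`Balanced 𝕜 s ∧ Convex ℝ s`. `StrongDual 𝕜 E` carries the topology of uniform convergence on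
(von Neumann) bounded subsets of `E`, i.e. it is the strong dual `E'_b`. -/

section LocallyConvex

variable (𝕜 : Type v) (E : Type u) [RCLike 𝕜] [AddCommGroup E] [Module 𝕜 E] [TopologicalSpace E]

/-- Quasi-barrelled: every closed absolutely convex set which absorbs all bounded sets is a
neighbourhood of zero. -/
def IsQuasiBarrelled [Module ℝ E] : Prop :=
  ∀ U : Set E, IsClosed U → Balanced 𝕜 U → Convex ℝ U →
    (∀ B : Set E, Bornology.IsVonNBounded 𝕜 B → Absorbs 𝕜 U B) → U ∈ 𝓝 (0 : E)

/-- Ultrabornological: `E` carries the inductive locally convex topology with respect to the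
continuous linear maps from Banach spaces into `E`, i.e. an absolutely convex set whose
preimages under all such maps are neighbourhoods of zero is a neighbourhood of zero.
(Banach spaces in the universe of `E` suffice: a map from any Banach space factors, through the
quotient by its kernel, over a Banach space whose underlying vector space is a subspace of `E`.) -/
def IsUltrabornological [Module ℝ E] : Prop :=
  ∀ U : Set E, Balanced 𝕜 U → Convex ℝ U →
    (∀ (X : Type u) [NormedAddCommGroup X] [NormedSpace 𝕜 X] [CompleteSpace X] (j : X →L[𝕜] E),
      j ⁻¹' U ∈ 𝓝 (0 : X)) →
    U ∈ 𝓝 (0 : E)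

/-- `C` is a web in `E`: a family of absolutely convex sets `C [n₁, …, nₖ]` (with the convention
`C [] = E`) such that the sets `C [n]` cover `E`, the sets `C [n₁, …, nₖ, n]` cover
`C [n₁, …, nₖ]`, and for every sequence `(nₖ)` there are `λₖ > 0` such that `∑ λₖ xₖ` converges
in `E` whenever `xₖ ∈ C [n₁, …, nₖ]` for all `k`. -/
structure IsWeb [Module ℝ E] (C : List ℕ → Set E) : Prop where
  balanced : ∀ l, Balanced 𝕜 (C l)
  convex : ∀ l, Convex ℝ (C l)
  nil : C [] = univ
  iUnion : ∀ l, ⋃ n : ℕ, C (l ++ [n]) = C l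
  converges : ∀ s : ℕ → ℕ, ∃ r : ℕ → ℝ, (∀ k, 0 < r k) ∧
    ∀ x : ℕ → E, (∀ k, x k ∈ C ((List.range (k + 1)).map s)) →
      ∃ y : E, Tendsto (fun N : ℕ => ∑ k ∈ Finset.range N, r k • x k) atTop (𝓝 y)

/-- Webbed: there is a web in `E`. -/
def IsWebbed [Module ℝ E] : Prop := ∃ C : List ℕ → Set E, IsWeb 𝕜 E C

variable {E} in
/-- The polar `U° ⊆ E'` of `U ⊆ E`, as a set of continuous linear functionals with the weak-star
topology `σ(E', E)`. -/
def weakStarPolar (U : Set E) : Set (WeakDual 𝕜 E) := {φ | ∀ x ∈ U, ‖φ x‖ ≤ 1}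

/-- `B_r`-complete: every `σ(E', E)`-dense linear subspace `H` of `E'` such that `H ∩ U°` is
`σ(E', E)`-closed for all neighbourhoods `U` of zero is equal to `E'`. -/
def IsBrComplete : Prop :=
  ∀ H : Submodule 𝕜 (WeakDual 𝕜 E), Dense (H : Set (WeakDual 𝕜 E)) →
    (∀ U ∈ 𝓝 (0 : E), IsClosed ((H : Set (WeakDual 𝕜 E)) ∩ weakStarPolar 𝕜 U)) → H = ⊤

end LocallyConvex

/-! ### Linearisations of function spaces -/

section FunctionSpace

variable {𝕜 : Type v} [RCLike 𝕜] {Ω : Type*}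

/-- A linear space `F` of `𝕜`-valued functions on `Ω`, without the topology of pointwise
convergence that a submodule of `Ω → 𝕜` would inherit, so that it can be given a topology of its
own. -/
def FunSpace (F : Submodule 𝕜 (Ω → 𝕜)) : Type _ := F

namespace FunSpace

variable (F : Submodule 𝕜 (Ω → 𝕜))

instance : AddCommGroup (FunSpace F) := inferInstanceAs (AddCommGroup F)

instance : Module 𝕜 (FunSpace F) := inferInstanceAs (Module 𝕜 F)

noncomputable instance : Module ℝ (FunSpace F) := inferInstanceAs (Module ℝ F)

instance : IsScalarTower ℝ 𝕜 (FunSpace F) := inferInstanceAs (IsScalarTower ℝ 𝕜 F)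

instance : CoeFun (FunSpace F) (fun _ => Ω → 𝕜) := ⟨fun f => Subtype.val f⟩

variable {F} in
/-- A function in `F` as an element of the function space. -/
def mk (f : Ω → 𝕜) (hf : f ∈ F) : FunSpace F := ⟨f, hf⟩

end FunSpace

variable (F : Submodule 𝕜 (Ω → 𝕜))

section Linearisation

variable {Y : Type*} [AddCommGroup Y] [Module 𝕜 Y] [TopologicalSpace Y]

/-- `(δ, Y, T)` is a linearisation of `F`: `T : F → Y'` is an algebraic isomorphism with
`T f ∘ δ = f` for all `f ∈ F`. -/
def IsLinearisation (δ : Ω → Y) (T : FunSpace F ≃ₗ[𝕜] StrongDual 𝕜 Y) : Prop :=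
  ∀ f : FunSpace F, (T f : Y → 𝕜) ∘ δ = f

/-- `(δ, Y, T)` is a strong linearisation of the topological vector space `F`: moreover
`T : F → Y'_b` is a topological isomorphism. -/
def IsStrongLinearisation [TopologicalSpace (FunSpace F)] (δ : Ω → Y)
    (T : FunSpace F ≃ₗ[𝕜] StrongDual 𝕜 Y) : Prop :=
  IsLinearisation F δ T ∧ IsHomeomorph T

end Linearisation

section WeakVectorValued

variable (E : Type*) [AddCommGroup E] [Module 𝕜 E] [TopologicalSpace E]

/-- The space `F(Ω, E)_σ` of functions `f : Ω → E` with `e' ∘ f ∈ F` for all `e' ∈ E'`. -/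
def weakFunctions : Set (Ω → E) := {f | ∀ e' : StrongDual 𝕜 E, (e' : E → 𝕜) ∘ f ∈ F}

/-- The space `F(Ω, E)_{σ,b}` of all `f ∈ F(Ω, E)_σ` such that `sup {q (e' ∘ f) | e' ∈ U_p°}` is
finite for all continuous seminorms `q` on `F` and `p` on `E`, where `U_p = {x | p x < 1}`. -/
def weakFunctionsBdd [TopologicalSpace (FunSpace F)] : Set (Ω → E) :=
  {f | ∃ hf : f ∈ weakFunctions F E,
    ∀ (q : Seminorm 𝕜 (FunSpace F)) (p : Seminorm 𝕜 E), Continuous q → Continuous p →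
      BddAbove ((fun e' : StrongDual 𝕜 E => q (FunSpace.mk ((e' : E → 𝕜) ∘ f) (hf e'))) ''
        {e' | ∀ x : E, p x < 1 → ‖e' x‖ ≤ 1})}

end WeakVectorValued

end FunctionSpace

section Chi

variable {𝕜 Ω Y E : Type*} [RCLike 𝕜] [AddCommGroup Y] [Module 𝕜 Y] [TopologicalSpace Y]
  [AddCommGroup E] [Module 𝕜 E] [TopologicalSpace E]

/-- The map `χ : L(Y, E) → F(Ω, E)_{σ,b}`, `χ u = u ∘ δ`. For a strong linearisation `(δ, Y, T)` of
`F` with `Y` quasi-barrelled and for complete `E`, the operator `T_E` is the inverse of `χ`. -/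
def chiMap (δ : Ω → Y) (w : Y →L[𝕜] E) : Ω → E := (w : Y → E) ∘ δ

end Chi

/-!
Put `R = T ∘ T'⁻¹ : Z' → Y'`, an algebraic isomorphism with `R z' (δ x) = z' (δ' x)`. The points
`δ x` span a dense subspace of `Y`, because a functional `T f` vanishing on them comes from
`f = T f ∘ δ = 0`. The condition `δ' ∈ F(Ω, Z)_{σ,b}` says that `T'⁻¹` maps equicontinuous sets to
bounded sets, so `R` maps them to strongly bounded sets, which are equicontinuous since `Y` is
quasi-barrelled. Hence `δ x ↦ δ' x` extends to a continuous linear map from the span of the `δ x`,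
and then, as `Z` is complete, to `S : Y → Z` (`IsQuasiBarrelled.exists_continuousLinearMap`). Its
transpose is `R`; as `R` is bijective, `S` is injective with dense range, and
`T'⁻¹ = T⁻¹ ∘ Sᵗ` is strongly continuous.

Continuity of `T'` is thus an open mapping problem for the continuous bijection `T'⁻¹`. It is
solved by De Wilde's theorem (`IsWebbed.continuous_symm`) when `Z'_b` is webbed and `F` is
ultrabornological, and by Pták's theorem (`IsBrComplete.continuous_symm`) when `Z'_b` is
`B_r`-complete and `F` is barrelled.

If `T'` is continuous and `Z` is barrelled, then `R⁻¹` maps the equicontinuous sets of `Y'`, which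
are strongly bounded, to bounded sets of `Z'_b`, which are equicontinuous. This means that
`S` is a topological embedding. It is onto when `Y` is complete, its range being closed and
dense. It is also onto when `Y` is `B_r`-complete (`IsBrComplete.surjective_of_isInducing`):
for `z` outside the range of `S`, the functionals on `Y` whose extension to `Z` vanishes at `z` form
a proper weak-star dense subspace whose intersections with the polars are weak-star closed. An
ultrabornological space is barrelled, so both cases of (d) follow.
-/

/-! ### Seminorms and the Hahn–Banach theorem -/

section HahnBanach

/-- Over `ℝ` or `ℂ`, a space that is locally convex as a real space has its topology defined by
`𝕜`-seminorms. -/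
theorem LocallyConvexSpace.polynormableSpace_of_real (𝕜 : Type*) (E : Type*) [RCLike 𝕜]
    [AddCommGroup E] [Module 𝕜 E] [Module ℝ E] [IsScalarTower ℝ 𝕜 E] [TopologicalSpace E]
    [IsTopologicalAddGroup E] [ContinuousSMul 𝕜 E] [LocallyConvexSpace ℝ E] :
    PolynormableSpace 𝕜 E := by
  have : ContinuousSMul ℝ E := IsScalarTower.continuousSMul (M := ℝ) (α := E) 𝕜
  open scoped ComplexOrder in
  have : LocallyConvexSpace 𝕜 E := by
    refine LocallyConvexSpace.ofBasisZero 𝕜 E (fun s : Set E => s)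
      (fun s : Set E => s ∈ 𝓝 (0 : E) ∧ Convex ℝ s)
      (LocallyConvexSpace.convex_basis_zero ℝ E) fun s hs => ?_
    exact convex_of_nonneg_surjective_algebraMap _
        (fun _ => RCLike.nonneg_iff_exists_ofReal.mp) hs.2
  open scoped ComplexOrder in
  exact LocallyConvexSpace.toPolynormableSpace

theorem Seminorm.le_of_forall_lt_one {𝕜 : Type*} [RCLike 𝕜] {E : Type*}
    [AddCommGroup E] [Module 𝕜 E] {p q : Seminorm 𝕜 E} (h : ∀ x, p x < 1 → q x ≤ 1) : q ≤ p := by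
  intro x
  refine le_of_forall_gt_imp_ge_of_dense fun c hc => ?_
  have hc0 : 0 < c := (apply_nonneg p x).trans_lt hc
  have hn : ‖((c : 𝕜))⁻¹‖ = c⁻¹ := by rw [norm_inv, RCLike.norm_ofReal, abs_of_pos hc0]
  have h1 := h ((c : 𝕜)⁻¹ • x) (by
    rw [map_smul_eq_mul, hn, inv_mul_lt_iff₀ hc0, mul_one]
    exact hc)
  rwa [map_smul_eq_mul, hn, inv_mul_le_iff₀ hc0, mul_one] at h1

variable {𝕜 : Type*} [RCLike 𝕜] {E : Type*} [AddCommGroup E] [Module 𝕜 E] [TopologicalSpace E]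

theorem Seminorm.setOf_lt_mem_nhds {p : Seminorm 𝕜 E} (hp : Continuous p) {r : ℝ} (hr : 0 < r) :
    {x | p x < r} ∈ 𝓝 (0 : E) :=
  (isOpen_lt hp continuous_const).mem_nhds (by simpa using hr)

theorem PolynormableSpace.exists_seminorm_of_mem_nhds [PolynormableSpace 𝕜 E] {U : Set E}
    (hU : U ∈ 𝓝 (0 : E)) :
    ∃ p : Seminorm 𝕜 E, Continuous p ∧ ∀ x, p x < 1 → x ∈ U := by
  have h := PolynormableSpace.withSeminorms 𝕜 E
  have := h.topologicalAddGroup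
  obtain ⟨s, r, hr, hs⟩ := (h.mem_nhds_iff 0 U).1 hU
  refine ⟨Real.toNNReal r⁻¹ • s.sup (fun p : {p : Seminorm 𝕜 E // Continuous p} => p.1),
    ?_, fun x hx => hs ?_⟩
  · exact (Seminorm.continuous_finsetSup fun i _ => i.2).const_smul _
  · rw [Seminorm.mem_ball_zero]
    have : (Real.toNNReal r⁻¹ : ℝ) *
        (s.sup (fun p : {p : Seminorm 𝕜 E // Continuous p} => p.1)) x < 1 := hx
    rw [Real.coe_toNNReal _ (inv_pos.2 hr).le] at this
    rwa [inv_mul_lt_iff₀ hr, mul_one] at this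

theorem LinearMap.continuous_of_forall_seminorm [IsTopologicalAddGroup E] {F : Type*}
    [AddCommGroup F] [Module 𝕜 F] [TopologicalSpace F] [PolynormableSpace 𝕜 F] (f : E →ₗ[𝕜] F)
    (h : ∀ p : Seminorm 𝕜 F, Continuous p →
      ∃ P : Seminorm 𝕜 E, Continuous P ∧ ∀ x, p (f x) ≤ P x) : Continuous f := by
  have := (PolynormableSpace.withSeminorms 𝕜 F).topologicalAddGroup
  refine continuous_of_continuousAt_zero f fun U hU => ?_
  rw [map_zero] at hU
  obtain ⟨p, hp, hpU⟩ := PolynormableSpace.exists_seminorm_of_mem_nhds (𝕜 := 𝕜) hU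
  obtain ⟨P, hP, hpP⟩ := h p hp
  exact mem_map.2 <| mem_of_superset (Seminorm.setOf_lt_mem_nhds hP one_pos)
    fun x hx => hpU _ ((hpP x).trans_lt hx)

/-- **Hahn–Banach**: a continuous seminorm is attained at `x` by a functional that it dominates. -/
theorem Seminorm.exists_strongDual_apply_eq [PolynormableSpace 𝕜 E] {p : Seminorm 𝕜 E}
    (hp : Continuous p) (x : E) :
    ∃ g : StrongDual 𝕜 E, ‖g x‖ = p x ∧ ∀ y, ‖g y‖ ≤ p y := by
  by_cases hx : x = 0
  · exact ⟨0, by simp [hx], fun y => by simp⟩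
  let f : Module.Dual 𝕜 (𝕜 ∙ x) :=
    (p x : 𝕜) • (LinearEquiv.toSpanNonzeroSingleton 𝕜 E x hx).symm.toLinearMap
  have key : ∀ c : 𝕜, ∀ h, f ⟨c • x, h⟩ = c * p x := fun c h => by
    have : (⟨c • x, h⟩ : 𝕜 ∙ x) = LinearEquiv.toSpanNonzeroSingleton 𝕜 E x hx c := rfl
    simp only [f, this, LinearMap.smul_apply, LinearEquiv.coe_coe, LinearEquiv.symm_apply_apply]
    rw [smul_eq_mul, mul_comm]
  obtain ⟨g, hg, hgp⟩ := Module.Dual.exists_continuous_extension_of_le_seminorm (𝕜 ∙ x) f hp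
    (by
      rintro ⟨y, hy⟩
      obtain ⟨c, rfl⟩ := Submodule.mem_span_singleton.1 hy
      rw [key, map_smul_eq_mul, norm_mul, RCLike.norm_ofReal, abs_of_nonneg (apply_nonneg _ _)])
  refine ⟨g, ?_, hgp⟩
  have h1 := hg ⟨(1 : 𝕜) • x, Submodule.mem_span_singleton.2 ⟨1, rfl⟩⟩
  rw [key] at h1
  simp only [one_smul, one_mul] at h1
  rw [h1, RCLike.norm_ofReal, abs_of_nonneg (apply_nonneg _ _)]

theorem PolynormableSpace.eq_zero_of_forall_strongDual [PolynormableSpace 𝕜 E] [T2Space E] {x : E}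
    (h : ∀ g : StrongDual 𝕜 E, g x = 0) : x = 0 := by
  by_contra hx
  obtain ⟨p, hp, hpx⟩ := PolynormableSpace.exists_seminorm_of_mem_nhds (𝕜 := 𝕜)
    (isOpen_compl_singleton.mem_nhds (Ne.symm hx) : ({x}ᶜ : Set E) ∈ 𝓝 0)
  obtain ⟨g, hg, -⟩ := Seminorm.exists_strongDual_apply_eq hp x
  rw [h g, norm_zero] at hg
  exact hpx x (by rw [← hg]; exact one_pos) rfl

/-- A subspace on which only the zero functional vanishes is dense. -/
theorem Submodule.dense_of_forall_strongDual [PolynormableSpace 𝕜 E] (M : Submodule 𝕜 E)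
    (h : ∀ g : StrongDual 𝕜 E, (∀ x ∈ M, g x = 0) → g = 0) : Dense (M : Set E) := by
  have := (PolynormableSpace.withSeminorms 𝕜 E).topologicalAddGroup
  have := (PolynormableSpace.withSeminorms 𝕜 E).continuousSMul
  let : Module ℝ E := .restrictScalars ℝ 𝕜 E
  have : IsScalarTower ℝ 𝕜 E := .restrictScalars _ _ _
  have := (PolynormableSpace.withSeminorms 𝕜 E).toLocallyConvexSpace
  have : ContinuousSMul ℝ E := IsScalarTower.continuousSMul (M := ℝ) (α := E) 𝕜
  intro x
  by_contra hx
  obtain ⟨f, u, hf, hfx⟩ := RCLike.geometric_hahn_banach_closed_point (𝕜 := 𝕜)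
    (M.restrictScalars ℝ).convex.closure isClosed_closure hx
  have hu : 0 < u := by simpa using hf 0 (subset_closure M.zero_mem)
  -- a functional with real part bounded above on a subspace vanishes there
  have hf0 : f = 0 := h f fun m hm => by
    by_contra hne
    have h1 := hf ((u * (f m)⁻¹ : 𝕜) • m) (subset_closure (M.smul_mem _ hm))
    rw [map_smul, smul_eq_mul, mul_assoc, inv_mul_cancel₀ hne, mul_one, RCLike.ofReal_re] at h1
    exact lt_irrefl _ h1
  rw [hf0] at hfx
  simp only [zero_apply, map_zero] at hfx
  exact lt_asymm hu hfx

end HahnBanach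

/-! ### Barrelled spaces and bounded sets in the dual -/

section Barrelled

variable {𝕜 : Type*} [RCLike 𝕜] {E : Type*} [AddCommGroup E] [Module 𝕜 E] [TopologicalSpace E]

/-- In the dual of a barrelled space, pointwise bounded sets are equicontinuous. -/
theorem BarrelledSpace.exists_seminorm_of_pointwise_bounded [IsTopologicalAddGroup E]
    [ContinuousSMul 𝕜 E] [BarrelledSpace 𝕜 E] (H : Set (StrongDual 𝕜 E))
    (hH : ∀ x, ∃ c : ℝ, ∀ φ ∈ H, ‖φ x‖ ≤ c) :
    ∃ p : Seminorm 𝕜 E, Continuous p ∧ ∀ φ ∈ H, ∀ x, ‖φ x‖ ≤ p x := by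
  let q : H → Seminorm 𝕜 E := fun φ => (φ : StrongDual 𝕜 E).toLinearMap.toSeminorm
  have hq : BddAbove (range q) := by
    rw [Seminorm.bddAbove_range_iff]
    intro x
    obtain ⟨c, hc⟩ := hH x
    exact ⟨c, by rintro _ ⟨φ, rfl⟩; exact hc φ φ.2⟩
  refine ⟨⨆ φ, q φ, ?_, ?_⟩
  · rw [Seminorm.coe_iSup_eq hq]
    exact Seminorm.continuous_iSup q (fun φ => φ.1.continuous.norm) hq
  intro φ hφ x
  rw [Seminorm.iSup_apply hq]
  exact le_ciSup (f := fun φ => q φ x) ((Seminorm.bddAbove_range_iff.1 hq) x) ⟨φ, hφ⟩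

/-- The unit ball of a lower semicontinuous seminorm has neighbourhoods of zero as preimages in
Banach spaces, since these are barrelled. -/
theorem IsUltrabornological.barrelledSpace {𝕜 : Type*} [RCLike 𝕜] {E : Type*} [AddCommGroup E]
    [Module 𝕜 E] [Module ℝ E] [IsScalarTower ℝ 𝕜 E] [TopologicalSpace E] [IsTopologicalAddGroup E]
    [ContinuousSMul 𝕜 E]
    (hE : IsUltrabornological 𝕜 E) : BarrelledSpace 𝕜 E where
  continuous_of_lowerSemicontinuous p hp := by
    refine Seminorm.continuous' (r := 1) (hE _ (p.balanced_closedBall_zero 1)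
      (p.convex_closedBall 0 1) fun X _ _ _ j => ?_)
    have hc : Continuous (p.comp j.toLinearMap) :=
      Seminorm.continuous_of_lowerSemicontinuous _
        (show LowerSemicontinuous (p ∘ j) from LowerSemicontinuous.comp hp j.continuous)
    refine mem_of_superset (Seminorm.setOf_lt_mem_nhds hc one_pos) fun x hx => ?_
    have hx : p (j x) < 1 := hx
    simpa [Seminorm.mem_closedBall] using hx.le

end Barrelled

section StrongDual

variable {𝕜 : Type*} [RCLike 𝕜] {E : Type*} [AddCommGroup E] [Module 𝕜 E] [TopologicalSpace E]

/-- Equicontinuous sets of functionals are strongly bounded. -/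
theorem Seminorm.isVonNBounded_setOf_le [PolynormableSpace 𝕜 E] {p : Seminorm 𝕜 E}
    (hp : Continuous p) :
    Bornology.IsVonNBounded 𝕜 {φ : StrongDual 𝕜 E | ∀ x, ‖φ x‖ ≤ p x} := by
  rw [ContinuousLinearMap.isVonNBounded_iff]
  intro s hs
  obtain ⟨c, hc⟩ := (PolynormableSpace.withSeminorms 𝕜 E).isVonNBounded_iff_seminorm_bddAbove.1 hs
    ⟨p, hp⟩
  rw [NormedSpace.isVonNBounded_iff, isBounded_iff_forall_norm_le]
  refine ⟨c, ?_⟩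
  rintro _ ⟨φ, hφ, x, hx, rfl⟩
  exact (hφ x).trans (hc (mem_image_of_mem _ hx))

theorem exists_norm_apply_le_of_isVonNBounded {H : Set (StrongDual 𝕜 E)}
    (hH : Bornology.IsVonNBounded 𝕜 H) {B : Set E} (hB : Bornology.IsVonNBounded 𝕜 B) :
    ∃ c : ℝ, ∀ φ ∈ H, ∀ x ∈ B, ‖φ x‖ ≤ c := by
  have := ContinuousLinearMap.isVonNBounded_image2_apply hH hB
  rw [NormedSpace.isVonNBounded_iff, isBounded_iff_forall_norm_le] at this
  obtain ⟨c, hc⟩ := this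
  exact ⟨c, fun φ hφ x hx => hc _ (mem_image2_of_mem hφ hx)⟩

end StrongDual

/-! ### Embeddings and `B_r`-complete spaces -/

section Embedding

variable {𝕜 : Type*} [RCLike 𝕜] {Y Z : Type*} [AddCommGroup Y] [Module 𝕜 Y]
  [AddCommGroup Z] [Module 𝕜 Z]

theorem ContinuousLinearMap.isInducing_of_forall_seminorm [TopologicalSpace Y] [TopologicalSpace Z]
    [IsTopologicalAddGroup Z] [PolynormableSpace 𝕜 Y] (S : Y →L[𝕜] Z)
    (h : ∀ p : Seminorm 𝕜 Y, Continuous p →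
      ∃ P : Seminorm 𝕜 Z, Continuous P ∧ ∀ y, p y ≤ P (S y)) : IsInducing S := by
  have := (PolynormableSpace.withSeminorms 𝕜 Y).topologicalAddGroup
  rw [IsTopologicalAddGroup.isInducing_iff_nhds_zero]
  refine le_antisymm ((map_zero S ▸ S.continuous.tendsto 0).le_comap) fun U hU => ?_
  obtain ⟨p, hp, hpU⟩ := PolynormableSpace.exists_seminorm_of_mem_nhds (𝕜 := 𝕜) hU
  obtain ⟨P, hP, hpP⟩ := h p hp
  refine mem_comap.2 ⟨{z | P z < 1},
    Seminorm.setOf_lt_mem_nhds hP one_pos, ?_⟩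
  exact fun y hy => hpU y ((hpP y).trans_lt hy)

theorem ContinuousLinearMap.surjective_of_isInducing_of_denseRange [UniformSpace Y]
    [IsUniformAddGroup Y] [CompleteSpace Y] [UniformSpace Z] [IsUniformAddGroup Z] [T2Space Z]
    (S : Y →L[𝕜] Z) (hS : IsInducing S) (hd : DenseRange S) : Function.Surjective S := by
  have h : IsUniformInducing S := AddMonoidHom.isUniformInducing_of_isInducing hS
  rw [← range_eq_univ, ← h.isComplete_range.isClosed.closure_eq]
  exact hd.closure_range

end Embedding

section BrComplete

variable {𝕜 : Type*} [RCLike 𝕜]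

/-- A subspace of the dual which separates points is weak-star dense. -/
theorem WeakDual.dense_of_separating {E : Type*} [AddCommGroup E] [Module 𝕜 E] [TopologicalSpace E]
    (H : Submodule 𝕜 (WeakDual 𝕜 E)) (h : ∀ x : E, (∀ φ ∈ H, φ x = 0) → x = 0) :
    Dense (H : Set (WeakDual 𝕜 E)) := by
  have : PolynormableSpace 𝕜 (WeakDual 𝕜 E) :=
    (LinearMap.weakBilin_withSeminorms (topDualPairing 𝕜 E)).toPolynormableSpace
  refine H.dense_of_forall_strongDual fun g hg => ?_
  obtain ⟨x, hx⟩ := LinearMap.dualEmbedding_surjective (topDualPairing 𝕜 E) g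
  have hx' : ∀ φ : WeakDual 𝕜 E, g φ = φ x := fun φ => by rw [← hx]; rfl
  have := h x fun φ hφ => by rw [← hx', hg φ hφ]
  ext φ
  rw [hx', this, map_zero, zero_apply]

theorem isClosed_weakStarPolar {E : Type*} [AddCommGroup E] [Module 𝕜 E] [TopologicalSpace E]
    (U : Set E) : IsClosed (weakStarPolar 𝕜 U) := by
  simp only [weakStarPolar, ofPred_forall]
  exact isClosed_biInter fun x _ =>
    isClosed_le (WeakDual.eval_continuous x).norm continuous_const

/-- **Banach–Alaoglu**: equicontinuous weak-star closed sets are weak-star compact. -/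
theorem WeakDual.isCompact_setOf_le {E : Type*} [AddCommGroup E] [Module 𝕜 E] [TopologicalSpace E]
    [IsTopologicalAddGroup E] {p : Seminorm 𝕜 E} (hp : Continuous p) :
    IsCompact {φ : WeakDual 𝕜 E | ∀ x, ‖φ x‖ ≤ p x} := by
  have hemb : IsEmbedding fun (φ : WeakDual 𝕜 E) (x : E) => φ x :=
    DFunLike.coe_injective.isEmbedding_induced
  rw [hemb.isCompact_iff]
  have himg : (fun (φ : WeakDual 𝕜 E) (x : E) => φ x) '' {φ : WeakDual 𝕜 E | ∀ x, ‖φ x‖ ≤ p x} =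
      range ((↑) : (E →ₗ[𝕜] 𝕜) → E → 𝕜) ∩ univ.pi fun x => Metric.closedBall 0 (p x) := by
    ext f
    constructor
    · rintro ⟨φ, hφ, rfl⟩
      exact ⟨⟨φ.toLinearMap, rfl⟩, fun x _ => by simpa using hφ x⟩
    · rintro ⟨⟨φ, rfl⟩, hφ⟩
      have hφ' : ∀ x, ‖φ x‖ ≤ p x := fun x => by simpa using hφ x (mem_univ x)
      have hc : Continuous φ := by
        refine continuous_of_continuousAt_zero φ ?_
        rw [ContinuousAt, map_zero]
        refine squeeze_zero_norm hφ' ?_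
        simpa using hp.tendsto 0
      exact ⟨(⟨φ, hc⟩ : StrongDual 𝕜 E), hφ', rfl⟩
  rw [himg]
  have h1 : IsCompact (univ.pi fun x : E => Metric.closedBall (0 : 𝕜) (p x)) :=
    isCompact_univ_pi fun x => ProperSpace.isCompact_closedBall _ _
  have h2 : IsClosed (range ((↑) : (E →ₗ[𝕜] 𝕜) → E → 𝕜)) :=
    LinearMap.isClosed_range_coe E 𝕜 (RingHom.id 𝕜)
  exact h1.inter_left h2

/-- A topological embedding `S` of a `B_r`-complete space with dense range is surjective. Here `R`
is the extension of functionals from `Y` to `Z`, the inverse of the transpose of `S`. -/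
theorem IsBrComplete.surjective_of_isInducing {Y Z : Type*} [AddCommGroup Y] [Module 𝕜 Y]
    [TopologicalSpace Y] [PolynormableSpace 𝕜 Y] [T2Space Y] [AddCommGroup Z] [Module 𝕜 Z]
    [TopologicalSpace Z] [PolynormableSpace 𝕜 Z] [T2Space Z]
    (hY : IsBrComplete 𝕜 Y) (S : Y →L[𝕜] Z) (hS : IsInducing S) (hd : DenseRange S)
    (R : WeakDual 𝕜 Y →ₗ[𝕜] StrongDual 𝕜 Z) (hR : ∀ y' y, R y' (S y) = y' y)
    (hR' : Function.Surjective R) :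
    Function.Surjective S := by
  have := (PolynormableSpace.withSeminorms 𝕜 Z).topologicalAddGroup
  have := (PolynormableSpace.withSeminorms 𝕜 Y).topologicalAddGroup
  have := (PolynormableSpace.withSeminorms 𝕜 Z).continuousSMul
  intro z
  by_contra hz
  -- the functionals whose extension to `Z` vanishes at `z`
  let ev : WeakDual 𝕜 Y →ₗ[𝕜] 𝕜 :=
    { toFun := fun y' => R y' z
      map_add' := fun a b => by simp
      map_smul' := fun a b => by simp }
  have hev : ∀ y', ev y' = R y' z := fun _ => rfl
  let H : Submodule 𝕜 (WeakDual 𝕜 Y) := LinearMap.ker ev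
  have hHmem : ∀ φ : WeakDual 𝕜 Y, φ ∈ LinearMap.ker ev ↔ R φ z = 0 := fun φ => LinearMap.mem_ker
  have hH : H = ⊤ := by
    refine hY H (WeakDual.dense_of_separating H fun y hy => ?_) fun U hU => ?_
    · -- evaluation at `y` vanishes on the kernel of evaluation at `z`, so is a multiple of it
      let evy : WeakDual 𝕜 Y →ₗ[𝕜] 𝕜 := (topDualPairing 𝕜 Y).flip y
      have hevy : ∀ y', evy y' = y' y := fun _ => rfl
      have hle : LinearMap.ker ev ≤ LinearMap.ker evy := fun φ hφ => hy φ hφ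
      obtain ⟨c, hc⟩ : ∃ c : 𝕜, ∀ y', evy y' = c * ev y' := by
        by_cases h0 : ev = 0
        · refine ⟨0, fun y' => ?_⟩
          rw [zero_mul]
          exact hle (by rw [h0]; simp)
        · obtain ⟨w, hw⟩ : ∃ w, ev w ≠ 0 := by
            by_contra hh; push Not at hh; exact h0 (LinearMap.ext hh)
          refine ⟨evy w / ev w, fun y' => ?_⟩
          have : y' - (ev y' / ev w) • w ∈ LinearMap.ker ev := by
            rw [LinearMap.mem_ker, map_sub, map_smul, smul_eq_mul, div_mul_cancel₀ _ hw, sub_self]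
          have := LinearMap.mem_ker.1 (hle this)
          rw [map_sub, map_smul, smul_eq_mul, sub_eq_zero] at this
          rw [this]; field_simp
      have hyz : S y = c • z := by
        rw [← sub_eq_zero]
        refine PolynormableSpace.eq_zero_of_forall_strongDual (𝕜 := 𝕜) fun g => ?_
        obtain ⟨y', rfl⟩ := hR' g
        rw [map_sub, map_smul, hR, ← hevy, hc, hev, smul_eq_mul, sub_self]
      have hc0 : c = 0 := by
        by_contra hc0
        exact hz ⟨c⁻¹ • y, by rw [map_smul, hyz, inv_smul_smul₀ hc0]⟩
      refine PolynormableSpace.eq_zero_of_forall_strongDual (𝕜 := 𝕜) fun g => ?_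
      rw [← StrongDual.toWeakDual_apply, ← hevy, hc, hc0, zero_mul]
    · -- on `U°` evaluation at `z` is a uniform limit of evaluations at points of `Y`
      obtain ⟨p, hp, hpU⟩ := PolynormableSpace.exists_seminorm_of_mem_nhds (𝕜 := 𝕜) hU
      obtain ⟨P, hP, hpP⟩ := Seminorm.exists_le_comp_of_isInducing (f := S.toLinearMap) hp hS
      have hRP : ∀ φ ∈ weakStarPolar 𝕜 U, ∀ z, ‖R φ z‖ ≤ P z := by
        intro φ hφ z
        refine hd.induction_on (p := fun z => ‖R φ z‖ ≤ P z) z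
          (isClosed_le (R φ).continuous.norm hP) fun y => ?_
        rw [hR]
        refine le_trans ?_ (hpP y)
        exact Seminorm.le_of_forall_lt_one (p := p)
          (q := (WeakDual.toStrongDual φ).toLinearMap.toSeminorm) (fun x hx => hφ x (hpU x hx)) y
      refine isClosed_of_closure_subset fun φ hφ => ?_
      have hφU : φ ∈ weakStarPolar 𝕜 U :=
        closure_minimal inter_subset_right (isClosed_weakStarPolar U) hφ
      refine ⟨(hHmem φ).2 ?_, hφU⟩
      refine norm_le_zero_iff.1 (le_of_forall_pos_le_add fun ε hε => ?_)
      obtain ⟨y, hy⟩ : ∃ y, P (z - S y) < ε / 2 := by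
        have : {w | P (z - w) < ε / 2} ∈ 𝓝 z :=
          (hP.comp (continuous_const.sub continuous_id)).continuousAt.eventually
            (gt_mem_nhds (by simpa using half_pos hε))
        obtain ⟨w, hw, y, rfl⟩ := (mem_closure_iff_nhds.1 (hd z)) _ this
        exact ⟨y, hw⟩
      have hbd : ∀ ψ ∈ weakStarPolar 𝕜 U, ‖R ψ z - ψ y‖ ≤ ε / 2 := fun ψ hψ => by
        have := (hRP ψ hψ (z - S y)).trans hy.le
        rwa [map_sub, hR] at this
      have hφy : ‖φ y‖ ≤ ε / 2 := by
        refine closure_minimal (t := {ψ : WeakDual 𝕜 Y | ‖ψ y‖ ≤ ε / 2}) ?_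
          (isClosed_le (WeakDual.eval_continuous y).norm continuous_const) hφ
        rintro ψ ⟨hψ, hψU⟩
        have := hbd ψ hψU
        rw [(hHmem ψ).1 hψ] at this
        simpa using this
      calc ‖R φ z‖ = ‖(R φ z - φ y) + φ y‖ := by rw [sub_add_cancel]
        _ ≤ ε / 2 + ε / 2 := (norm_add_le _ _).trans (add_le_add (hbd φ hφU) hφy)
        _ = 0 + ε := by ring
  refine hz ⟨0, ?_⟩
  rw [map_zero]
  refine (PolynormableSpace.eq_zero_of_forall_strongDual (𝕜 := 𝕜) fun g => ?_).symm
  obtain ⟨y', rfl⟩ := hR' g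
  have : y' ∈ H := hH ▸ Submodule.mem_top
  exact (hHmem y').1 this

/-- **Pták's open mapping theorem** for bijections: the range of the transpose of `A` is weak-star
dense and meets every polar of a neighbourhood of zero in a weak-star compact set, so every
functional on `E` factors through `A`, and Hahn–Banach shows that `A` is open. -/
theorem IsBrComplete.continuous_symm {E G : Type*} [AddCommGroup E] [Module 𝕜 E]
    [TopologicalSpace E] [PolynormableSpace 𝕜 E] [AddCommGroup G] [Module 𝕜 G]
    [TopologicalSpace G] [PolynormableSpace 𝕜 G] [T2Space G] [BarrelledSpace 𝕜 G]
    (hE : IsBrComplete 𝕜 E) (A : E ≃ₗ[𝕜] G) (hA : Continuous A) : Continuous A.symm := by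
  have := (PolynormableSpace.withSeminorms 𝕜 G).topologicalAddGroup
  have := (PolynormableSpace.withSeminorms 𝕜 G).continuousSMul
  -- equicontinuity on `E` passes to `G` since `G` is barrelled
  have hequi : ∀ p : Seminorm 𝕜 E, Continuous p → ∃ P : Seminorm 𝕜 G, Continuous P ∧
      ∀ φ : StrongDual 𝕜 G, (∀ x, ‖φ (A x)‖ ≤ p x) → ∀ y, ‖φ y‖ ≤ P y := fun p _ =>
    BarrelledSpace.exists_seminorm_of_pointwise_bounded {φ | ∀ x, ‖φ (A x)‖ ≤ p x}
      fun y => ⟨p (A.symm y), fun φ hφ => by simpa using hφ (A.symm y)⟩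
  let AL : E →L[𝕜] G := ⟨A.toLinearMap, hA⟩
  let At : WeakDual 𝕜 G →ₗ[𝕜] WeakDual 𝕜 E :=
    { toFun := fun φ => StrongDual.toWeakDual ((WeakDual.toStrongDual φ).comp AL)
      map_add' := fun _ _ => rfl
      map_smul' := fun _ _ => rfl }
  have hAt : ∀ φ x, At φ x = φ (A x) := fun _ _ => rfl
  have hAtc : Continuous At := WeakDual.continuous_of_continuous_eval fun x =>
    WeakDual.eval_continuous (A x)
  have hrange : LinearMap.range At = ⊤ := by
    refine hE _ (WeakDual.dense_of_separating _ fun x hx => ?_) fun U hU => ?_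
    · rw [← A.map_eq_zero_iff]
      exact PolynormableSpace.eq_zero_of_forall_strongDual (𝕜 := 𝕜) fun g =>
        hx (At (StrongDual.toWeakDual g)) ⟨_, rfl⟩
    · obtain ⟨p, hp, hpU⟩ := PolynormableSpace.exists_seminorm_of_mem_nhds (𝕜 := 𝕜) hU
      obtain ⟨P, hP, hpP⟩ := hequi p hp
      have himg : (LinearMap.range At : Set (WeakDual 𝕜 E)) ∩ weakStarPolar 𝕜 U =
          At '' (At ⁻¹' weakStarPolar 𝕜 U) := by
        rw [image_preimage_eq_inter_range, inter_comm, LinearMap.coe_range]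
      rw [himg]
      refine IsCompact.isClosed (IsCompact.image ?_ hAtc)
      refine (WeakDual.isCompact_setOf_le hP).of_isClosed_subset
        ((isClosed_weakStarPolar U).preimage hAtc) fun φ hφ => hpP (WeakDual.toStrongDual φ) ?_
      exact Seminorm.le_of_forall_lt_one (p := p)
        (q := (WeakDual.toStrongDual (At φ)).toLinearMap.toSeminorm)
        fun x hx => hφ x (hpU x hx)
  refine A.symm.toLinearMap.continuous_of_forall_seminorm fun p hp => ?_
  obtain ⟨P, hP, hpP⟩ := hequi p hp
  refine ⟨P, hP, fun y => ?_⟩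
  obtain ⟨f, hf, hfp⟩ := Seminorm.exists_strongDual_apply_eq hp (A.symm y)
  obtain ⟨φ, hφ⟩ : StrongDual.toWeakDual f ∈ LinearMap.range At := hrange ▸ Submodule.mem_top
  have hφ' : ∀ x, φ (A x) = f x := fun x => by rw [← hAt, hφ]; rfl
  have := hpP (WeakDual.toStrongDual φ) (fun x => (congrArg norm (hφ' x)).trans_le (hfp x)) y
  refine hf.symm.trans_le (le_trans (le_of_eq ?_) this)
  rw [← hφ', A.apply_symm_apply]
  rfl

end BrComplete

/-! ### Maps out of a quasi-barrelled space -/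

section Extension

variable {𝕜 : Type*} [RCLike 𝕜] {Y Z Ω : Type*} [AddCommGroup Y] [Module 𝕜 Y] [Module ℝ Y]
  [IsScalarTower ℝ 𝕜 Y]
  [UniformSpace Y] [IsUniformAddGroup Y] [PolynormableSpace 𝕜 Y] [AddCommGroup Z] [Module 𝕜 Z]
  [UniformSpace Z] [IsUniformAddGroup Z] [PolynormableSpace 𝕜 Z] [T2Space Z] [CompleteSpace Z]

/-- On the dual of a quasi-barrelled space, strongly bounded sets are equicontinuous. -/
theorem IsQuasiBarrelled.mem_nhds_of_isVonNBounded {Y : Type*} [AddCommGroup Y] [Module 𝕜 Y]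
    [Module ℝ Y] [IsScalarTower ℝ 𝕜 Y] [TopologicalSpace Y] (hY : IsQuasiBarrelled 𝕜 Y)
    {H : Set (StrongDual 𝕜 Y)}
    (hH : Bornology.IsVonNBounded 𝕜 H) : {y | ∀ φ ∈ H, ‖φ y‖ ≤ 1} ∈ 𝓝 (0 : Y) := by
  have heq : {y | ∀ φ ∈ H, ‖φ y‖ ≤ 1} =
      ⋂ φ ∈ H, φ.toLinearMap.toSeminorm.closedBall (0 : Y) 1 := by
    ext y
    simp only [mem_ofPred_eq, mem_iInter, Seminorm.mem_closedBall, sub_zero]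
    rfl
  refine hY _ ?_ ?_ ?_ fun B hB => ?_
  · simp only [ofPred_forall]
    exact isClosed_biInter fun φ _ => isClosed_le φ.continuous.norm continuous_const
  · rw [heq]
    exact balanced_iInter₂ fun φ _ => Seminorm.balanced_closedBall_zero _ _
  · rw [heq]
    exact convex_iInter₂ fun φ _ => Seminorm.convex_closedBall _ _ _
  · obtain ⟨c, hc⟩ := exists_norm_apply_le_of_isVonNBounded hH hB
    refine absorbs_iff_norm.2 ⟨max c 1, fun a ha => ?_⟩
    have ha0 : 0 < ‖a‖ := one_pos.trans_le ((le_max_right _ _).trans ha)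
    intro y hy
    rw [mem_smul_set_iff_inv_smul_mem₀ (norm_pos_iff.1 ha0)]
    intro φ hφ
    rw [map_smul, norm_smul, norm_inv, inv_mul_le_iff₀ ha0, mul_one]
    exact (hc φ hφ y hy).trans ((le_max_left _ _).trans ha)

/-- If `δ` has dense span and `R : Z' → Y'` is compatible with `δ` and `δ'`, and maps equicontinuous
sets to bounded sets, then `δ x ↦ δ' x` extends to a continuous linear map `Y → Z`. -/
theorem IsQuasiBarrelled.exists_continuousLinearMap (hY : IsQuasiBarrelled 𝕜 Y) (δ : Ω → Y)
    (δ' : Ω → Z) (hd : Dense (Submodule.span 𝕜 (range δ) : Set Y))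
    (R : StrongDual 𝕜 Z → StrongDual 𝕜 Y) (hR : ∀ z' x, R z' (δ x) = z' (δ' x))
    (hb : ∀ p : Seminorm 𝕜 Z, Continuous p →
      Bornology.IsVonNBounded 𝕜 (R '' {z' | ∀ z, ‖z' z‖ ≤ p z})) :
    ∃ S : Y →L[𝕜] Z, ∀ x, S (δ x) = δ' x := by
  have := (PolynormableSpace.withSeminorms 𝕜 Y).continuousSMul
  have := (PolynormableSpace.withSeminorms 𝕜 Z).continuousSMul
  -- the map `L a ↦ L' a` on the span of the `δ x` is defined through a linear right inverse of `L`
  let L := Finsupp.linearCombination 𝕜 δ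
  let L' := Finsupp.linearCombination 𝕜 δ'
  have hLL' : ∀ z' a, z' (L' a) = R z' (L a) := fun z' a => by
    have : z'.toLinearMap ∘ₗ L' = (R z').toLinearMap ∘ₗ L := by
      ext x
      simp [L, L', hR]
    exact LinearMap.congr_fun this a
  obtain ⟨s, hs⟩ := L.rangeRestrict.exists_rightInverse_of_surjective L.range_rangeRestrict
  have hs' : ∀ y : LinearMap.range L, L (s y) = y := fun y =>
    congrArg Subtype.val (LinearMap.congr_fun hs y)
  let S₀ : LinearMap.range L →ₗ[𝕜] Z := L' ∘ₗ s
  have hS₀ : ∀ z' y, z' (S₀ y) = R z' y := fun z' y => by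
    rw [← hs' y]
    exact hLL' z' (s y)
  have hS₀c : Continuous S₀ := by
    refine S₀.continuous_of_forall_seminorm fun p hp => ?_
    obtain ⟨P, hP, hPV⟩ := PolynormableSpace.exists_seminorm_of_mem_nhds (𝕜 := 𝕜)
      (hY.mem_nhds_of_isVonNBounded (hb p hp))
    refine ⟨P.comp (LinearMap.range L).subtype, hP.comp continuous_subtype_val, ?_⟩
    refine Seminorm.le_of_forall_lt_one (q := p.comp S₀) fun y hy => ?_
    obtain ⟨g, hg, hgp⟩ := Seminorm.exists_strongDual_apply_eq hp (S₀ y)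
    have := hPV y hy (R g) (mem_image_of_mem R hgp)
    rw [Seminorm.comp_apply, ← hg, hS₀]
    exact this
  have hdense : DenseRange (LinearMap.range L).subtypeL := by
    have : range (LinearMap.range L).subtypeL = (Submodule.span 𝕜 (range δ) : Set Y) := by
      rw [← Finsupp.range_linearCombination]
      exact Subtype.range_coe
    rw [DenseRange, this]
    exact hd
  have : IsUniformAddGroup (LinearMap.range L) :=
    inferInstanceAs (IsUniformAddGroup (LinearMap.range L).toAddSubgroup)
  refine ⟨ContinuousLinearMap.extend ⟨S₀, hS₀c⟩ (LinearMap.range L).subtypeL, fun x => ?_⟩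
  have hx : δ x ∈ LinearMap.range L := ⟨Finsupp.single x 1, by simp [L]⟩
  have := ContinuousLinearMap.extend_eq (⟨S₀, hS₀c⟩ : LinearMap.range L →L[𝕜] Z) hdense
    (isUniformInducing_val _) ⟨δ x, hx⟩
  refine Eq.trans this (sub_eq_zero.1
    (PolynormableSpace.eq_zero_of_forall_strongDual (𝕜 := 𝕜) fun g => ?_))
  rw [map_sub, sub_eq_zero, ← hR]
  exact hS₀ g ⟨δ x, hx⟩

end Extension

/-! ### Webs and De Wilde's theorem -/

section Webbed

open scoped Pointwise

/-- In the preimage of a web under a map from a Baire space, some branch consists of non-meagre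
sets. -/
theorem IsWeb.exists_branch_not_isMeagre {𝕜 E X : Type*} [RCLike 𝕜] [AddCommGroup E] [Module 𝕜 E]
    [TopologicalSpace E] [Module ℝ E] {C : List ℕ → Set E} (hC : IsWeb 𝕜 E C)
    [TopologicalSpace X] [BaireSpace X] [Nonempty X] (g : X → E) :
    ∃ s : ℕ → ℕ, ∀ k, ¬ IsMeagre (g ⁻¹' C ((List.range k).map s)) := by
  have hstep : ∀ l, ¬ IsMeagre (g ⁻¹' C l) → ∃ n, ¬ IsMeagre (g ⁻¹' C (l ++ [n])) := by
    intro l hl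
    by_contra! h
    rw [← hC.iUnion l, preimage_iUnion] at hl
    exact hl (isMeagre_iUnion h)
  choose! n hn using hstep
  let l : ℕ → List ℕ := fun k => Nat.rec [] (fun _ l => l ++ [n l]) k
  have hl : ∀ k, l k = (List.range k).map fun j => n (l j) := by
    intro k
    induction k with
    | zero => rfl
    | succ k ih =>
      rw [List.range_succ, List.map_append, ← ih]
      rfl
  refine ⟨fun j => n (l j), fun k => ?_⟩
  rw [← hl]
  induction k with
  | zero =>
    change ¬ IsMeagre (g ⁻¹' C [])
    rw [hC.nil, preimage_univ]
    exact not_isMeagre_of_isOpen isOpen_univ univ_nonempty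
  | succ k ih => exact hn _ ih

/-- A symmetric convex set which is not meagre has a closure with an interior point `x`, and then
`0`, as the midpoint of `x` and `-x`, is interior too. -/
theorem Convex.closure_mem_nhds_zero_of_not_isMeagre {X : Type*} [AddCommGroup X] [Module ℝ X]
    [TopologicalSpace X] [IsTopologicalAddGroup X] [ContinuousSMul ℝ X] {D : Set X}
    (hD : Convex ℝ D) (hsymm : ∀ x ∈ D, -x ∈ D) (h : ¬ IsMeagre D) : closure D ∈ 𝓝 (0 : X) := by
  have hne : (interior (closure D)).Nonempty := by
    rw [nonempty_iff_ne_empty]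
    exact fun h0 => h (IsNowhereDense.isMeagre h0)
  obtain ⟨x, hx⟩ := hne
  have hneg : -closure D = closure D := by
    rw [neg_closure]
    congr 1
    ext y
    exact ⟨fun hy => by simpa using hsymm _ hy, fun hy => hsymm y hy⟩
  have hx' : -x ∈ interior (closure D) := by
    rw [← hneg]
    have := (Homeomorph.neg X).preimage_interior (closure D)
    change -interior (closure D) = interior (-closure D) at this
    rw [← this]
    simpa using hx
  have := hD.closure.interior hx hx' (a := 1 / 2) (b := 1 / 2) (by norm_num) (by norm_num)
    (by norm_num)
  rw [smul_neg, add_neg_cancel] at this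
  exact mem_interior_iff_mem_nhds.1 this

/-- Along a branch of a web, the sets rescaled by `r` are eventually contained in the unit ball of
any given continuous seminorm: otherwise one could choose infinitely many terms outside of it,
although the terms of a convergent series tend to zero. -/
theorem exists_forall_ge_seminorm_smul_le_one {E : Type*} [AddCommGroup E] [Module ℝ E]
    [TopologicalSpace E] [IsTopologicalAddGroup E] {D : ℕ → Set E} (h0 : ∀ k, (0 : E) ∈ D k)
    {r : ℕ → ℝ}
    (hconv : ∀ x : ℕ → E, (∀ k, x k ∈ D k) →
      ∃ y : E, Tendsto (fun N : ℕ => ∑ k ∈ Finset.range N, r k • x k) atTop (𝓝 y))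
    {p : Seminorm ℝ E} (hp : Continuous p) :
    ∃ K, ∀ k ≥ K, ∀ x ∈ D k, p (r k • x) ≤ 1 := by
  by_contra! h
  have hx : ∀ k, ∃ x ∈ D k, (∃ x' ∈ D k, 1 < p (r k • x')) → 1 < p (r k • x) := by
    intro k
    by_cases hk : ∃ x' ∈ D k, 1 < p (r k • x')
    · obtain ⟨x, hx, hpx⟩ := hk
      exact ⟨x, hx, fun _ => hpx⟩
    · exact ⟨0, h0 k, fun h => absurd h hk⟩
  choose x hxD hx using hx
  obtain ⟨y, hy⟩ := hconv x hxD
  have hterm : Tendsto (fun k => r k • x k) atTop (𝓝 0) := by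
    have := (hy.comp (tendsto_add_atTop_nat 1)).sub hy
    simpa [Function.comp_def, Finset.sum_range_succ] using this
  obtain ⟨K, hK⟩ := eventually_atTop.1
    (hterm.eventually (Seminorm.setOf_lt_mem_nhds hp one_pos))
  obtain ⟨k, hk, x', hx', hpx'⟩ := h K
  exact lt_asymm (hK k hk) (hx k ⟨x', hx', hpx'⟩)

/-- **De Wilde's closed graph theorem**, for a linear map with sequentially closed graph from a
Banach space to a webbed space. A small vector `x` is written as a series whose terms lie in
rescaled preimages of a branch of the web, by successive approximation as in the open mapping
theorem; the web makes the image series converge, with a small sum, which is `g x` by the closedness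
of the graph. -/
theorem IsWeb.continuous_of_isSeqClosed_graph {E X : Type*} [AddCommGroup E] [Module ℝ E]
    [TopologicalSpace E] [IsTopologicalAddGroup E] [LocallyConvexSpace ℝ E] [ContinuousSMul ℝ E]
    {C : List ℕ → Set E} (hC : IsWeb ℝ E C) [NormedAddCommGroup X] [NormedSpace ℝ X]
    [CompleteSpace X] (g : X →ₗ[ℝ] E)
    (hg : ∀ (x : ℕ → X) (a : X) (b : E), Tendsto x atTop (𝓝 a) →
      Tendsto (fun n => g (x n)) atTop (𝓝 b) → g a = b) : Continuous g := by
  have := LocallyConvexSpace.polynormableSpace_of_real ℝ E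
  obtain ⟨s, hs⟩ := hC.exists_branch_not_isMeagre g
  obtain ⟨r, hr, hconv⟩ := hC.converges s
  let D : ℕ → Set E := fun k => C ((List.range (k + 1)).map s)
  have hD0 : ∀ k, (0 : E) ∈ D k := fun k => by
    obtain ⟨x, hx⟩ := nonempty_of_not_isMeagre (hs (k + 1))
    exact (hC.balanced _).zero_mem ⟨_, hx⟩
  -- the weights `2⁻ᵏ⁻¹ r k` make the tails of the series small
  let c : ℕ → ℝ := fun k => (1 / 2) ^ (k + 1) * r k
  have hc : ∀ k, 0 < c k := fun k => mul_pos (by positivity) (hr k)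
  have hB : ∀ k, closure (c k • (g ⁻¹' D k)) ∈ 𝓝 (0 : X) := fun k => by
    rw [closure_smul₀' (hc k).ne']
    refine (set_smul_mem_nhds_zero_iff (hc k).ne').2 ?_
    refine ((hC.convex _).linear_preimage g).closure_mem_nhds_zero_of_not_isMeagre
      (fun x hx => ?_) (hs (k + 1))
    rw [mem_preimage, map_neg]
    exact (hC.balanced _).neg_mem_iff.2 hx
  have hε : ∀ k, ∃ ε > 0, ε ≤ (1 / 2 : ℝ) ^ k ∧
      ∀ x : X, ‖x‖ < ε → x ∈ closure (c k • (g ⁻¹' D k)) := fun k => by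
    obtain ⟨ε, hε, h⟩ := Metric.mem_nhds_iff.1 (hB k)
    refine ⟨min ε ((1 / 2) ^ k), lt_min hε (by positivity), min_le_right _ _, fun x hx => h ?_⟩
    rw [mem_ball_zero_iff]
    exact hx.trans_le (min_le_left _ _)
  choose ε hε0 hε1 hε using hε
  have hstep : ∀ k (e : X), ‖e‖ < ε k → ∃ d, g d ∈ D k ∧ ‖e - c k • d‖ < ε (k + 1) := by
    intro k e he
    obtain ⟨_, ⟨d, hd, rfl⟩, hdist⟩ := Metric.mem_closure_iff.1 (hε k e he) _ (hε0 (k + 1))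
    exact ⟨d, hd, by rwa [← dist_eq_norm]⟩
  choose! d hdD hd using hstep
  refine g.continuous_of_forall_seminorm fun p hp => ?_
  obtain ⟨K, hK⟩ := exists_forall_ge_seminorm_smul_le_one hD0 hconv hp
  -- it suffices to bound `p ∘ g` on the ball of radius `ε K`
  suffices h : ∀ x, ‖x‖ < ε K → p (g x) ≤ 1 by
    refine ⟨Real.toNNReal (ε K)⁻¹ • normSeminorm ℝ X,
      continuous_const.mul continuous_norm, ?_⟩
    refine Seminorm.le_of_forall_lt_one (q := p.comp g) fun x hx => h x ?_
    have : (Real.toNNReal (ε K)⁻¹ : ℝ) * ‖x‖ < 1 := hx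
    rwa [Real.coe_toNNReal _ (inv_pos.2 (hε0 K)).le, inv_mul_lt_iff₀ (hε0 K), mul_one] at this
  intro x hx
  -- the remainders of the successive approximation of `x`
  let e : ℕ → X := fun n => Nat.rec x (fun n e => e - c (K + n) • d (K + n) e) n
  have he_succ : ∀ n, e (n + 1) = e n - c (K + n) • d (K + n) (e n) := fun _ => rfl
  have he : ∀ n, ‖e n‖ < ε (K + n) := by
    intro n
    induction n with
    | zero => exact hx
    | succ n ih => exact hd _ _ ih
  have hsum : ∀ N, ∑ n ∈ Finset.range N, c (K + n) • d (K + n) (e n) = x - e N := by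
    intro N
    induction N with
    | zero => simp [e]
    | succ N ih => rw [Finset.sum_range_succ, ih, he_succ]; abel
  have he0 : Tendsto e atTop (𝓝 0) := by
    refine squeeze_zero_norm (a := fun n => (1 / 2 : ℝ) ^ n) (fun n => ?_)
      (tendsto_pow_atTop_nhds_zero_of_lt_one (by norm_num) (by norm_num))
    exact ((he n).le.trans (hε1 _)).trans
      (pow_le_pow_of_le_one (by norm_num) (by norm_num) (Nat.le_add_left _ _))
  have hlim : Tendsto (fun N => ∑ n ∈ Finset.range N, c (K + n) • d (K + n) (e n)) atTop
      (𝓝 x) := by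
    simp only [hsum]
    simpa using tendsto_const_nhds.sub he0
  -- the same series in `E`, padded with zeros in front
  let y : ℕ → E := fun k => if K ≤ k then (1 / 2 : ℝ) ^ (k + 1) • g (d k (e (k - K))) else 0
  have hyK : ∀ n, r (K + n) • y (K + n) = g (c (K + n) • d (K + n) (e n)) := fun n => by
    simp only [y, Nat.le_add_right, if_true, Nat.add_sub_cancel_left, map_smul, c]
    rw [smul_smul, mul_comm]
  have hyD : ∀ k, y k ∈ D k := fun k => by
    by_cases hk : K ≤ k
    · obtain ⟨n, rfl⟩ := Nat.exists_eq_add_of_le hk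
      simp only [y, Nat.le_add_right, if_true, Nat.add_sub_cancel_left]
      refine (hC.balanced _).smul_mem ?_ (hdD _ _ (he n))
      rw [norm_pow]
      exact pow_le_one₀ (norm_nonneg _) (by norm_num)
    · simp only [y, hk, if_false]
      exact hD0 k
  obtain ⟨b, hb⟩ := hconv y hyD
  have hgsum : ∀ N, ∑ k ∈ Finset.range (K + N), r k • y k =
      g (∑ n ∈ Finset.range N, c (K + n) • d (K + n) (e n)) := fun N => by
    rw [Finset.sum_range_add, map_sum, Finset.sum_eq_zero, zero_add]
    · exact Finset.sum_congr rfl fun n _ => hyK n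
    · intro k hk
      have : ¬ K ≤ k := by simpa using hk
      simp only [y, this, if_false, smul_zero]
  have hb' : Tendsto (fun N => g (∑ n ∈ Finset.range N, c (K + n) • d (K + n) (e n))) atTop
      (𝓝 b) := by
    simp only [← hgsum]
    exact hb.comp (tendsto_atTop_mono (fun N => Nat.le_add_left N K) tendsto_id)
  rw [hg _ x b hlim hb']
  refine le_of_tendsto ((hp.tendsto b).comp hb') (Eventually.of_forall fun N => ?_)
  have hterm : ∀ n, p (g (c (K + n) • d (K + n) (e n))) ≤ (1 / 2 : ℝ) ^ (n + 1) := fun n => by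
    have h1 := hK (K + n) (Nat.le_add_right _ _) _ (hdD _ _ (he n))
    simp only [c]
    rw [map_smul, mul_smul, map_smul_eq_mul, norm_pow]
    calc ‖(1 / 2 : ℝ)‖ ^ (K + n + 1) * p (r (K + n) • g (d (K + n) (e n)))
        ≤ ‖(1 / 2 : ℝ)‖ ^ (K + n + 1) * 1 := by gcongr
      _ = (1 / 2 : ℝ) ^ (K + n + 1) := by norm_num
      _ ≤ (1 / 2 : ℝ) ^ (n + 1) :=
        pow_le_pow_of_le_one (by norm_num) (by norm_num) (by omega)
  have hgeom : ∀ N, ∑ n ∈ Finset.range N, (1 / 2 : ℝ) ^ (n + 1) = 1 - (1 / 2) ^ N := by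
    intro N
    induction N with
    | zero => simp
    | succ N ih => rw [Finset.sum_range_succ, ih]; ring
  simp only [Function.comp_apply, map_sum]
  calc p (∑ n ∈ Finset.range N, g (c (K + n) • d (K + n) (e n)))
      ≤ ∑ n ∈ Finset.range N, p (g (c (K + n) • d (K + n) (e n))) :=
        Finset.le_sum_of_subadditive p (map_zero p).le (map_add_le_add p) _ _
    _ ≤ ∑ n ∈ Finset.range N, (1 / 2 : ℝ) ^ (n + 1) := Finset.sum_le_sum fun n _ => hterm n
    _ ≤ 1 := by rw [hgeom]; linarith [pow_pos (one_half_pos (α := ℝ)) N]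

theorem IsWeb.real {𝕜 E : Type*} [RCLike 𝕜] [AddCommGroup E] [Module 𝕜 E] [TopologicalSpace E]
    [Module ℝ E] [IsScalarTower ℝ 𝕜 E] {C : List ℕ → Set E} (hC : IsWeb 𝕜 E C) : IsWeb ℝ E C where
  balanced l := by
    rw [balanced_iff_smul_mem]
    intro a ha x hx
    rw [← algebraMap_smul 𝕜 a x]
    exact (hC.balanced l).smul_mem (by simpa using ha) hx
  convex := hC.convex
  nil := hC.nil
  iUnion := hC.iUnion
  converges := hC.converges

/-- **De Wilde's open mapping theorem** for bijections. -/
theorem IsWebbed.continuous_symm {𝕜 E G : Type*} [RCLike 𝕜] [AddCommGroup E] [Module 𝕜 E]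
    [Module ℝ E] [IsScalarTower ℝ 𝕜 E] [TopologicalSpace E] [IsTopologicalAddGroup E]
    [ContinuousSMul 𝕜 E] [LocallyConvexSpace ℝ E] [AddCommGroup G] [Module 𝕜 G] [Module ℝ G]
    [IsScalarTower ℝ 𝕜 G] [TopologicalSpace G] [IsTopologicalAddGroup G] [T2Space G]
    (hE : IsWebbed 𝕜 E) (hG : IsUltrabornological 𝕜 G) (A : E ≃ₗ[𝕜] G) (hA : Continuous A) :
    Continuous A.symm := by
  have : ContinuousSMul ℝ E := IsScalarTower.continuousSMul (M := ℝ) (α := E) 𝕜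
  have := LocallyConvexSpace.polynormableSpace_of_real 𝕜 E
  obtain ⟨C, hC⟩ := hE
  refine continuous_of_continuousAt_zero A.symm fun U hU => ?_
  rw [map_zero] at hU
  obtain ⟨p, hp, hpU⟩ := PolynormableSpace.exists_seminorm_of_mem_nhds (𝕜 := 𝕜) hU
  let q : Seminorm 𝕜 G := p.comp A.symm.toLinearMap
  refine mem_map.2 (mem_of_superset (hG (q.ball 0 1) (q.balanced_ball_zero 1) (q.convex_ball 0 1)
    fun X _ _ _ j => ?_) fun y hy => hpU _ (by simpa [Seminorm.mem_ball] using! hy))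
  let : NormedSpace ℝ X := .restrictScalars ℝ 𝕜 X
  have : IsScalarTower ℝ 𝕜 X := .restrictScalars _ _ _
  have hcont : Continuous ((A.symm.toLinearMap ∘ₗ j.toLinearMap).restrictScalars ℝ) := by
    refine hC.real.continuous_of_isSeqClosed_graph _ fun x a b hx hb => ?_
    -- the graph of `A⁻¹ ∘ j` is closed since `A` is continuous
    have h1 := (hA.tendsto b).comp hb
    have h2 : Tendsto (fun n => j (x n)) atTop (𝓝 (A b)) := by
      simpa [Function.comp_def] using h1
    have h3 := tendsto_nhds_unique ((j.continuous.tendsto a).comp hx) h2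
    simpa [LinearEquiv.symm_apply_eq] using h3
  have hopen : IsOpen {x : X | p (A.symm (j x)) < 1} :=
    isOpen_lt (hp.comp hcont) continuous_const
  refine mem_of_superset (hopen.mem_nhds (by simp)) fun x hx => ?_
  rw [mem_preimage, Seminorm.mem_ball, sub_zero]
  exact hx

end Webbed

/-! ### Linearisations -/

section Linearisation

variable {𝕜 Ω : Type*} [RCLike 𝕜] {F : Submodule 𝕜 (Ω → 𝕜)} {Y : Type*} [AddCommGroup Y]
  [Module 𝕜 Y] [TopologicalSpace Y] {δ : Ω → Y} {T : FunSpace F ≃ₗ[𝕜] StrongDual 𝕜 Y}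

theorem IsLinearisation.apply_symm (hT : IsLinearisation F δ T) (y' : StrongDual 𝕜 Y) :
    (T.symm y' : Ω → 𝕜) = y' ∘ δ := by
  rw [← hT (T.symm y'), T.apply_symm_apply]

/-- The point evaluations `δ x` span a dense subspace: a functional `T f` vanishing on all of them
comes from `f = T f ∘ δ = 0`. -/
theorem IsLinearisation.dense_span_range [PolynormableSpace 𝕜 Y] (hT : IsLinearisation F δ T) :
    Dense (Submodule.span 𝕜 (range δ) : Set Y) := by
  refine Submodule.dense_of_forall_strongDual _ fun g hg => ?_
  have h : T.symm g = 0 := by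
    refine Subtype.ext ?_
    change (T.symm g : Ω → 𝕜) = 0
    rw [hT.apply_symm]
    exact funext fun x => hg _ (Submodule.subset_span (mem_range_self x))
  rwa [map_eq_zero_iff T.symm T.symm.injective] at h

/-- For `δ' ∈ F(Ω, Z)_{σ,b}`, the inverse of a linearisation `(δ', Z, T')` maps equicontinuous sets
to bounded sets. -/
theorem IsLinearisation.isVonNBounded_image_symm [TopologicalSpace (FunSpace F)]
    [PolynormableSpace 𝕜 (FunSpace F)] (hT : IsLinearisation F δ T)
    (hδ : δ ∈ weakFunctionsBdd F Y) {p : Seminorm 𝕜 Y} (hp : Continuous p) :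
    Bornology.IsVonNBounded 𝕜 (T.symm '' {y' | ∀ y, ‖y' y‖ ≤ p y}) := by
  obtain ⟨hσ, hb⟩ := hδ
  refine (PolynormableSpace.withSeminorms 𝕜 (FunSpace F)).isVonNBounded_iff_seminorm_bddAbove.2 ?_
  rintro ⟨q, hq⟩
  refine (hb q p hq hp).mono ?_
  rintro _ ⟨_, ⟨y', hy', rfl⟩, rfl⟩
  refine ⟨y', fun y hy => (hy' y).trans hy.le, congrArg q (Subtype.ext ?_)⟩
  exact (hT.apply_symm y').symm

end Linearisation

/-- The operator `S` below is `T_Z(δ') = χ⁻¹(δ')`, the unique `S ∈ L(Y, Z)` with `S ∘ δ = δ'`. -/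
theorem mainTheorem5 {𝕜 : Type*} [RCLike 𝕜] {Ω : Type*} [Nonempty Ω]
    -- a locally convex Hausdorff space of `𝕜`-valued functions on `Ω`
    (F : Submodule 𝕜 (Ω → 𝕜))
    [TopologicalSpace (FunSpace F)] [IsTopologicalAddGroup (FunSpace F)]
    [ContinuousSMul 𝕜 (FunSpace F)] [LocallyConvexSpace ℝ (FunSpace F)] [T2Space (FunSpace F)]
    -- locally convex Hausdorff spaces `Y` and `Z`
    {Y : Type*} [AddCommGroup Y] [Module 𝕜 Y] [Module ℝ Y] [IsScalarTower ℝ 𝕜 Y]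
    [UniformSpace Y] [IsUniformAddGroup Y] [ContinuousSMul 𝕜 Y] [LocallyConvexSpace ℝ Y]
    [T2Space Y]
    {Z : Type*} [AddCommGroup Z] [Module 𝕜 Z] [Module ℝ Z] [IsScalarTower ℝ 𝕜 Z]
    [UniformSpace Z] [IsUniformAddGroup Z] [ContinuousSMul 𝕜 Z] [LocallyConvexSpace ℝ Z]
    [T2Space Z]
    -- the strong linearisation `(δ, Y, T)` and the linearisation `(δ', Z, T')`
    (δ : Ω → Y) (T : FunSpace F ≃ₗ[𝕜] StrongDual 𝕜 Y)
    (hT : IsStrongLinearisation F δ T) (hY : IsQuasiBarrelled 𝕜 Y)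
    (δ' : Ω → Z) (T' : FunSpace F ≃ₗ[𝕜] StrongDual 𝕜 Z)
    (hT' : IsLinearisation F δ' T') (hZ : CompleteSpace Z)
    (hδ' : δ' ∈ weakFunctionsBdd F Z) :
    ∃ S : Y →L[𝕜] Z,
      (∀ w : Y →L[𝕜] Z, chiMap δ w = δ' ↔ w = S) ∧
      -- (a)
      (Function.Injective S ∧ DenseRange S ∧
        Continuous (T'.symm : StrongDual 𝕜 Z → FunSpace F) ∧
        ∀ z' : StrongDual 𝕜 Z, z'.comp S = T (T'.symm z')) ∧
      -- (b)
      ((IsWebbed 𝕜 (StrongDual 𝕜 Z) ∧ IsUltrabornological 𝕜 (FunSpace F)) ∨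
        (IsBrComplete 𝕜 (StrongDual 𝕜 Z) ∧ BarrelledSpace 𝕜 (FunSpace F)) →
        IsHomeomorph T') ∧
      -- (c)
      (CompleteSpace Y → BarrelledSpace 𝕜 Z → Continuous T' → Function.Surjective S) ∧
      -- (d)
      (Continuous T' →
        (CompleteSpace Y ∧ IsWebbed 𝕜 Y ∧ IsUltrabornological 𝕜 Z) ∨
          (IsBrComplete 𝕜 Y ∧ BarrelledSpace 𝕜 Z) →
        IsHomeomorph S) := by
  have : ContinuousSMul ℝ (FunSpace F) :=
    IsScalarTower.continuousSMul (M := ℝ) (α := FunSpace F) 𝕜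
  have := LocallyConvexSpace.polynormableSpace_of_real 𝕜 (FunSpace F)
  have := LocallyConvexSpace.polynormableSpace_of_real 𝕜 Y
  have := LocallyConvexSpace.polynormableSpace_of_real 𝕜 Z
  have := LocallyConvexSpace.polynormableSpace_of_real 𝕜 (StrongDual 𝕜 Z)
  obtain ⟨hTlin, hThomeo⟩ := hT
  have hTsymm : Continuous T.symm :=
    (T.toEquiv.toHomeomorphOfIsInducing hThomeo.isInducing).symm.continuous
  let TL : FunSpace F →L[𝕜] StrongDual 𝕜 Y := ⟨T.toLinearMap, hThomeo.continuous⟩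
  let TLsymm : StrongDual 𝕜 Y →L[𝕜] FunSpace F := ⟨T.symm.toLinearMap, hTsymm⟩
  -- `R = T ∘ T'⁻¹` will be the transpose of `S`
  let R : StrongDual 𝕜 Z ≃ₗ[𝕜] StrongDual 𝕜 Y := T'.symm.trans T
  have hR : ∀ z' x, R z' (δ x) = z' (δ' x) := fun z' x => by
    have h1 := congrFun (hTlin (T'.symm z')) x
    have h2 := congrFun (hT'.apply_symm z') x
    exact h1.trans h2
  have hspan := hTlin.dense_span_range
  obtain ⟨S, hS⟩ := hY.exists_continuousLinearMap δ δ' hspan R hR fun p hp => by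
    have := (hT'.isVonNBounded_image_symm hδ' hp).image TL
    rwa [← image_comp] at this
  have hSR : ∀ z', z'.comp S = R z' := fun z' =>
    ContinuousLinearMap.ext_on hspan (by rintro _ ⟨x, rfl⟩; simp [hS, hR])
  have hSR' : ∀ y' y, R.symm y' (S y) = y' y := fun y' y => by
    have := DFunLike.congr_fun (hSR (R.symm y')) y
    rwa [R.apply_symm_apply] at this
  have hinj : Function.Injective S := by
    refine (injective_iff_map_eq_zero S).2 fun y hy => ?_
    refine PolynormableSpace.eq_zero_of_forall_strongDual (𝕜 := 𝕜) fun g => ?_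
    rw [← hSR', hy, map_zero]
  have hdense : DenseRange S := by
    refine Submodule.dense_of_forall_strongDual (LinearMap.range S.toLinearMap) fun g hg => ?_
    rw [← R.map_eq_zero_iff, ← hSR]
    exact ContinuousLinearMap.ext fun y => hg _ ⟨y, rfl⟩
  have hT'symm : Continuous T'.symm := by
    have h : Continuous fun z' : StrongDual 𝕜 Z => T.symm (z'.comp S) :=
      hTsymm.comp (S.precomp 𝕜).continuous
    convert h using 2 with z'
    rw [hSR]
    exact (T.symm_apply_apply _).symm
  -- if `Z` is barrelled and `T'` continuous, the functionals on `Y` below a continuous seminorm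
  -- form a bounded set, whose extensions to `Z` are equicontinuous
  have hind : BarrelledSpace 𝕜 Z → Continuous T' → IsInducing S := fun _ hT'c => by
    let RL : StrongDual 𝕜 Y →L[𝕜] StrongDual 𝕜 Z := ⟨R.symm.toLinearMap, hT'c.comp hTsymm⟩
    refine S.isInducing_of_forall_seminorm fun p hp => ?_
    have hbdd := (Seminorm.isVonNBounded_setOf_le hp).image RL
    obtain ⟨P, hP, hPle⟩ := BarrelledSpace.exists_seminorm_of_pointwise_bounded _ fun z => by
      obtain ⟨c, hc⟩ := exists_norm_apply_le_of_isVonNBounded hbdd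
        (Bornology.isVonNBounded_singleton (𝕜 := 𝕜) z)
      exact ⟨c, fun φ hφ => hc φ hφ z rfl⟩
    refine ⟨P, hP, fun y => ?_⟩
    obtain ⟨g, hg, hgp⟩ := Seminorm.exists_strongDual_apply_eq hp y
    rw [← hg, ← hSR']
    exact hPle _ (mem_image_of_mem _ hgp) _
  have hsurj : CompleteSpace Y → BarrelledSpace 𝕜 Z → Continuous T' → Function.Surjective S :=
    fun _ hZb hT'c => S.surjective_of_isInducing_of_denseRange (hind hZb hT'c) hdense
  have hhomeo : IsInducing S → Function.Surjective S → IsHomeomorph S := fun h hs =>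
    isHomeomorph_iff_isEmbedding_surjective.2 ⟨⟨h, hinj⟩, hs⟩
  refine ⟨S, fun w => ⟨fun hw => ?_, ?_⟩, ⟨hinj, hdense, hT'symm, hSR⟩, fun h => ?_, hsurj,
    fun hT'c h => ?_⟩
  · exact ContinuousLinearMap.ext_on hspan (by
      rintro _ ⟨x, rfl⟩
      rw [hS, ← hw]
      rfl)
  · rintro rfl
    exact funext hS
  · have hT'c : Continuous T' := by
      rcases h with ⟨hw, hu⟩ | ⟨hB, _⟩
      · exact hw.continuous_symm hu T'.symm hT'symm
      · exact hB.continuous_symm T'.symm hT'symm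
    exact (Homeomorph.mk T'.toEquiv hT'c hT'symm).isHomeomorph
  · rcases h with ⟨hYc, -, hu⟩ | ⟨hB, hZb⟩
    · have := hu.barrelledSpace
      exact hhomeo (hind this hT'c) (hsurj hYc this hT'c)
    · refine hhomeo (hind hZb hT'c) (hB.surjective_of_isInducing S (hind hZb hT'c) hdense
        (R.symm.toLinearMap ∘ₗ WeakDual.toStrongDual.toLinearMap) (fun y' y => ?_) ?_)
      · exact hSR' (WeakDual.toStrongDual y') y
      · exact R.symm.surjective.comp WeakDual.toStrongDual.surjective
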